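/- Let $\mathbb D$ be the open unit disc in $\mathbb C$ and $\mathbb B=\{z\in\mathbb C^2:\|z\|<1\}$ the Euclidean unit ball. For a domain $D\subset\mathbb C^n$ (a nonempty connected open set) let $\mathcal O(\mathbb D,D)$ denote the set of holomorphic maps $\mathbb D\to D$, let $$\tilde k_D(z,w)=\inf\{\tanh^{-1}|\alpha|:\alpha\in\mathbb D,\ \exists\varphi\in\mathcal O(\mathbb D,D):\varphi(0)=z,\ \varphi(\alpha)=w\}$$ be its Lempert function, let $$k_D^{(2)}(z,w)=\inf\{\tilde k_D(z,z_1)+\tilde k_D(z_1,w):z_1\in D\},$$ and put $(k_D^{(2)})^*=\tanh k_D^{(2)}$. The domain $D$ is balanced if $\lambda z\in D$ for all $z\in D$ and $\lambda\in\mathbb C$ with $|\lambda|\le 1$; it is pseudoconvex if $-\log\operatorname{dist}(\cdot,\mathbb C^n\setminus D)$ is plurisubharmonic on $D$; and it is taut if $\mathcal O(\mathbb D,D)$ is a normal family, i.e. every sequence in $\mathcal O(\mathbb D,D)$ has a subsequence that either converges locally uniformly on $\mathbb D$ to an element of $\mathcal O(\mathbb D,D)$ or is compactly divergent (for all compact $K\subset\mathbb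 D$, $L\subset D$, its members eventually map $K$ into the complement of $L$). There exists a plurisubharmonic function $\psi:\mathbb C^2\to[0,\infty)$ with $\psi(\lambda z)=|\lambda|\psi(z)$ for all $\lambda\in\mathbb C$, $z\in\mathbb C^2$, with $\psi\not\equiv0$, and with $\psi=0$ on a dense subset of $\mathbb C^2$, such that $$D=\{z\in\mathbb C^2:\|z\|+\psi(z)<1\}$$ is a pseudoconvex balanced domain which is a proper subset of $\mathbb B$, is not taut, has convex hull equal to $\mathbb B$, and satisfies $$(k_D^{(2)}(0,a))^*=\|a\|\qquad\text{for all }a\in D.$$ -/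

import Mathlib

open Set Filter Topology MeasureTheory
open scoped ENNReal

/-- The space `ℂⁿ` with its Euclidean norm. -/
abbrev Cn (n : ℕ) : Type := EuclideanSpace ℂ (Fin n)

/-- The open unit disc `𝔻` of the complex plane. -/
def unitDisc : Set ℂ := Metric.ball 0 1

/-- A domain: a nonempty connected open set. -/
def IsDomainIn {n : ℕ} (D : Set (Cn n)) : Prop := IsOpen D ∧ IsConnected D

/-- The set `𝒪(𝔻, D)` of holomorphic maps from the unit disc to `D`
(only the values on the disc matter). -/
def HolDisc {n : ℕ} (D : Set (Cn n)) : Set (ℂ → Cn n) :=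
  {φ | DifferentiableOn ℂ φ unitDisc ∧ MapsTo φ unitDisc D}

/-- Mean value over the circle of a function with values in `[-∞, ∞]`: the integral of the
positive part minus the integral of the negative part, over the circle of total mass one
parametrized by `t ∈ (0, 1]`, `t ↦ exp (2πit)`. -/
noncomputable def circleMean (v : ℂ → EReal) : EReal :=
  ((∫⁻ t in Ioc (0 : ℝ) 1, (v (Complex.exp (2 * Real.pi * t * Complex.I))).toENNReal : ℝ≥0∞)
      : EReal) -
    ((∫⁻ t in Ioc (0 : ℝ) 1, (-(v (Complex.exp (2 * Real.pi * t * Complex.I)))).toENNReal : ℝ≥0∞)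
      : EReal)

/-- `u` is plurisubharmonic on `D` (`D` open): it is upper semicontinuous on `D` with values in
`[-∞, ∞)` and satisfies the sub-mean value inequality on every closed affine disc contained
in `D`. The function that is constantly `-∞` is allowed. -/
def IsPSH {n : ℕ} (u : Cn n → EReal) (D : Set (Cn n)) : Prop :=
  UpperSemicontinuousOn u D ∧ (∀ z ∈ D, u z ≠ ⊤) ∧
    ∀ a b : Cn n, (∀ ζ : ℂ, ‖ζ‖ ≤ 1 → a + ζ • b ∈ D) → u a ≤ circleMean fun ζ => u (a + ζ • b)

/-- `D` is pseudoconvex: `-log dist (·, ℂⁿ \ D)` is plurisubharmonic on `D`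
(with `dist (·, ∅) = ∞`, `log ∞ = ∞`). -/
def IsPseudoconvex {n : ℕ} (D : Set (Cn n)) : Prop :=
  IsPSH (fun z => -ENNReal.log (Metric.infEDist z Dᶜ)) D

/-- `D` is taut: `𝒪(𝔻, D)` is a normal family, i.e. every sequence in it has a subsequence that
converges locally uniformly on the disc to an element of `𝒪(𝔻, D)` or is compactly divergent. -/
def IsTaut {n : ℕ} (D : Set (Cn n)) : Prop :=
  ∀ φ : ℕ → ℂ → Cn n, (∀ k, φ k ∈ HolDisc D) →
    ∃ s : ℕ → ℕ, StrictMono s ∧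
      ((∃ g ∈ HolDisc D, TendstoLocallyUniformlyOn (fun k => φ (s k)) g atTop unitDisc) ∨
        ∀ K ⊆ unitDisc, IsCompact K → ∀ L ⊆ D, IsCompact L →
          ∀ᶠ k in atTop, Disjoint (φ (s k) '' K) L)

/-- The Lempert function of `D`; the infimum is taken in `[0, ∞]`. -/
noncomputable def lempert {n : ℕ} (D : Set (Cn n)) (z w : Cn n) : ℝ≥0∞ :=
  sInf {t | ∃ φ ∈ HolDisc D, ∃ α ∈ unitDisc, φ 0 = z ∧ φ α = w ∧
    t = ENNReal.ofReal (Real.artanh ‖α‖)}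

/-- The `m`-th Lempert function of `D`: infimum over chains of `m` steps in `D`. -/
noncomputable def lempertChain {n : ℕ} (D : Set (Cn n)) (m : ℕ) (z w : Cn n) : ℝ≥0∞ :=
  sInf {t | ∃ p : Fin (m + 1) → Cn n, (∀ j, p j ∈ D) ∧ p 0 = z ∧ p (Fin.last m) = w ∧
    t = ∑ j : Fin m, lempert D (p j.castSucc) (p j.succ)}

/-- The hyperbolic tangent on `[0, ∞]`, with `tanh ∞ = 1`. -/
noncomputable def tanhExt (x : ℝ≥0∞) : ℝ := if x = ⊤ then 1 else Real.tanh x.toReal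

/-! Take countably many linear forms whose zero lines are dense in ℂ² and let ψ be the product of
`|lⱼ| ^ cⱼ`, with the missing degree supplied by a power of `‖z‖`. Normalizing `|lⱼ z| ≤ ‖z‖` makes
the partial products decrease, so the limit is upper semicontinuous; small `cⱼ` keep it nonzero at
`(1, 0)`. Each partial product satisfies the sub-mean value inequality by Jensen's formula
(`psiPartial_le_integral`), and dominated convergence carries this to ψ.

On the dense cone ψ = 0, D coincides with the ball. This gives the convex hull, the failure of
tautness (discs in the cone converge to a disc leaving D), and the value of the two-step function:
go radially to a point of the cone near `a`, then make a cheap jump to `a` inside a small ball.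
Schwarz-Pick for linear forms gives the opposite bound.

Pseudoconvexity follows from a disc principle (`isPseudoconvex_of_entire_discs`), which D satisfies
because `‖z‖ + ψ(z)` has the sub-mean value property along entire discs. -/

/-! ### Circle means and sub-mean value inequalities -/

/-- The parametrization `t ↦ exp (2πit)` of the unit circle. -/
noncomputable def unitCirc (t : ℝ) : ℂ := Complex.exp (2 * Real.pi * t * Complex.I)

lemma norm_unitCirc (t : ℝ) : ‖unitCirc t‖ = 1 := by
  have : unitCirc t = Complex.exp (((2 * Real.pi * t : ℝ) : ℂ) * Complex.I) := by
    simp [unitCirc]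
  rw [this, Complex.norm_exp_ofReal_mul_I]

lemma continuous_unitCirc : Continuous unitCirc := by
  unfold unitCirc; fun_prop

lemma unitCirc_eq_circleMap (t : ℝ) : unitCirc t = circleMap 0 1 (2 * Real.pi * t) := by
  simp [unitCirc, circleMap]

/-- The length measure on the parameter interval `(0, 1]` of the circle. -/
noncomputable abbrev circParam : Measure ℝ := volume.restrict (Ioc (0 : ℝ) 1)

instance : IsProbabilityMeasure circParam := ⟨by simp [circParam]⟩

lemma circleAverage_eq_integral_unitCirc {F : Type*} [NormedAddCommGroup F] [NormedSpace ℝ F]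
    (f : ℂ → F) :
    Real.circleAverage f 0 1 = ∫ t, f (unitCirc t) ∂circParam := by
  have h := intervalIntegral.integral_comp_mul_left (a := 0) (b := 1)
    (fun θ => f (circleMap 0 1 θ)) (c := 2 * Real.pi) (by positivity)
  rw [Real.circleAverage_def]
  simp only [mul_zero, mul_one] at h
  rw [← h, intervalIntegral.integral_of_le zero_le_one]
  simp only [unitCirc_eq_circleMap]

lemma integrable_of_circleIntegrable {f : ℂ → ℝ} (hf : CircleIntegrable f 0 1) :
    Integrable (fun t => f (unitCirc t)) circParam := by
  have h := IntervalIntegrable.comp_mul_left (c := 2 * Real.pi) hf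
  rw [zero_div, div_self (by positivity), intervalIntegrable_iff_integrableOn_Ioc_of_le zero_le_one]
    at h
  simp only [unitCirc_eq_circleMap]
  exact h

lemma integrable_of_continuous_circParam {F : Type*} [NormedAddCommGroup F] {w : ℝ → F}
    (hw : Continuous w) : Integrable w circParam :=
  (hw.integrableOn_Icc (a := 0) (b := 1)).mono_set Ioc_subset_Icc_self

lemma injOn_unitCirc : InjOn unitCirc (Ioc 0 1) := by
  intro s hs t ht h
  unfold unitCirc at h
  rw [Complex.exp_eq_exp_iff_exists_int] at h
  obtain ⟨n, hn⟩ := h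
  have h2 : (2 * Real.pi * Complex.I : ℂ) ≠ 0 := Complex.two_pi_I_ne_zero
  have h3 : (s : ℂ) = t + n := by
    apply mul_left_cancel₀ h2
    linear_combination hn
  have h4 : s = t + n := by exact_mod_cast h3
  have h5 : (-1 : ℝ) < n := by linarith [hs.1, ht.2]
  have h6 : (n : ℝ) < 1 := by linarith [hs.2, ht.1]
  have h7 : n = 0 := by
    have a1 : -1 < n := by exact_mod_cast h5
    have a2 : n < 1 := by exact_mod_cast h6
    omega
  simpa [h7] using h4

lemma ae_unitCirc_ne_zero {f : ℂ → ℂ} (hf : Differentiable ℂ f) (h0 : f 0 ≠ 0) :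
    ∀ᵐ t ∂circParam, f (unitCirc t) ≠ 0 := by
  have hc : (Metric.sphere (0 : ℂ) 1 ∩ {z | f z = 0}).Finite := by
    by_contra hinf
    obtain ⟨x, -, hx⟩ := Set.Infinite.exists_accPt_of_subset_isCompact hinf
      (isCompact_sphere (0 : ℂ) 1) inter_subset_left
    have hfr : ∃ᶠ z in 𝓝[≠] x, f z = 0 :=
      (accPt_iff_frequently_nhdsNE.1 hx).mono fun z hz => hz.2
    have := AnalyticOnNhd.eqOn_zero_of_preconnected_of_frequently_eq_zero
      (fun z _ => hf.analyticAt z) isPreconnected_univ (mem_univ x) hfr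
    exact h0 (this (mem_univ 0))
  rw [ae_restrict_iff' measurableSet_Ioc, ae_iff]
  refine (Set.Finite.countable ?_).measure_zero _
  refine Set.Finite.of_finite_image (f := unitCirc) (hc.subset ?_) (injOn_unitCirc.mono ?_)
  · rintro _ ⟨t, ht, rfl⟩
    simp only [mem_ofPred_eq, Classical.not_imp, not_not] at ht
    exact ⟨by simp [norm_unitCirc], ht.2⟩
  · intro t ht
    simp only [mem_ofPred_eq, Classical.not_imp, not_not] at ht
    exact ht.1

/-- Jensen's formula: the two sides differ by the sum of `log (1 / ‖u‖)` over the zeros `u` in the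
closed disc, counted with multiplicity, and each term is nonnegative. -/
lemma log_norm_le_integral {f : ℂ → ℂ} (hf : Differentiable ℂ f) (h0 : f 0 ≠ 0) :
    Integrable (fun t => Real.log ‖f (unitCirc t)‖) circParam ∧
      Real.log ‖f 0‖ ≤ ∫ t, Real.log ‖f (unitCirc t)‖ ∂circParam := by
  have ha : AnalyticOnNhd ℂ f univ := fun x _ => hf.analyticAt x
  refine ⟨integrable_of_circleIntegrable (f := fun z => Real.log ‖f z‖)
    ((ha.mono (subset_univ _)).meromorphicOn.circleIntegrable_log_norm), ?_⟩
  rw [← circleAverage_eq_integral_unitCirc (fun z => Real.log ‖f z‖)]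
  have ha' := ha.mono (subset_univ (Metric.closedBall (0 : ℂ) |1|))
  rw [ha'.circleAverage_log_norm one_ne_zero h0]
  refine le_add_of_nonneg_left (finsum_nonneg fun u => ?_)
  by_cases hu : u ∈ Metric.closedBall (0 : ℂ) |1|
  · refine mul_nonneg ?_ ?_
    · exact_mod_cast (MeromorphicOn.AnalyticOnNhd.divisor_nonneg ha') u
    · rcases eq_or_ne u 0 with rfl | hu0
      · simp
      · refine Real.log_nonneg ?_
        have : ‖u‖ ≤ 1 := by simpa using hu
        rw [one_mul, zero_sub, norm_neg]
        exact (one_le_inv₀ (norm_pos_iff.2 hu0)).2 this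
  · rw [Function.locallyFinsuppWithin.apply_eq_zero_of_notMem _ hu]; simp

/-- The weighted sum of the `log ‖f i‖` has the sub-mean value property, and Jensen's inequality for
the convex function `exp` transfers it to the product. A factor vanishing at 0 makes the left side
zero. -/
lemma prod_rpow_le_integral {ι : Type*} (s : Finset ι) {f : ι → ℂ → ℂ} {c : ι → ℝ}
    (hf : ∀ i ∈ s, Differentiable ℂ (f i)) (hc : ∀ i ∈ s, 0 < c i) :
    ∏ i ∈ s, ‖f i 0‖ ^ c i ≤ ∫ t, ∏ i ∈ s, ‖f i (unitCirc t)‖ ^ c i ∂circParam := by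
  by_cases h0 : ∃ i ∈ s, f i 0 = 0
  · obtain ⟨i, hi, h⟩ := h0
    rw [Finset.prod_eq_zero hi (by rw [h, norm_zero, Real.zero_rpow (hc i hi).ne'])]
    exact integral_nonneg fun t => Finset.prod_nonneg fun i _ => by positivity
  push Not at h0
  have hae : (fun t => Real.exp (∑ i ∈ s, c i * Real.log ‖f i (unitCirc t)‖)) =ᵐ[circParam]
      fun t => ∏ i ∈ s, ‖f i (unitCirc t)‖ ^ c i := by
    have : ∀ᵐ t ∂circParam, ∀ i ∈ s, f i (unitCirc t) ≠ 0 :=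
      (Finset.eventually_all s).2 fun i hi => ae_unitCirc_ne_zero (hf i hi) (h0 i hi)
    filter_upwards [this] with t ht
    rw [Real.exp_sum]
    refine Finset.prod_congr rfl fun i hi => ?_
    rw [Real.rpow_def_of_pos (norm_pos_iff.2 (ht i hi)), mul_comm]
  have hcont : Continuous fun t => ∏ i ∈ s, ‖f i (unitCirc t)‖ ^ c i :=
    continuous_finsetProd s fun i hi =>
      (((hf i hi).continuous.comp continuous_unitCirc).norm).rpow_const fun _ => Or.inr (hc i hi).le
  have hint := integrable_of_continuous_circParam hcont
  have hlog : Integrable (fun t => ∑ i ∈ s, c i * Real.log ‖f i (unitCirc t)‖) circParam :=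
    integrable_finsetSum s fun i hi => (log_norm_le_integral (hf i hi) (h0 i hi)).1.const_mul _
  calc ∏ i ∈ s, ‖f i 0‖ ^ c i = Real.exp (∑ i ∈ s, c i * Real.log ‖f i 0‖) := by
        rw [Real.exp_sum]
        refine Finset.prod_congr rfl fun i hi => ?_
        rw [Real.rpow_def_of_pos (norm_pos_iff.2 (h0 i hi)), mul_comm]
    _ ≤ Real.exp (∫ t, ∑ i ∈ s, c i * Real.log ‖f i (unitCirc t)‖ ∂circParam) := by
        refine Real.exp_le_exp.2 ?_
        rw [integral_finsetSum s fun i hi =>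
          (log_norm_le_integral (hf i hi) (h0 i hi)).1.const_mul _]
        refine Finset.sum_le_sum fun i hi => ?_
        rw [integral_const_mul]
        exact mul_le_mul_of_nonneg_left (log_norm_le_integral (hf i hi) (h0 i hi)).2 (hc i hi).le
    _ ≤ ∫ t, Real.exp (∑ i ∈ s, c i * Real.log ‖f i (unitCirc t)‖) ∂circParam :=
        convexOn_exp.map_integral_le Real.continuous_exp.continuousOn isClosed_univ
          (by simp) hlog (hint.congr hae.symm)
    _ = _ := integral_congr_ae hae

lemma circleMean_coe_of_integrable {w : ℂ → ℝ}
    (hw : Integrable (fun t => w (unitCirc t)) circParam) :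
    circleMean (fun ζ => (w ζ : EReal)) = ((∫ t, w (unitCirc t) ∂circParam : ℝ) : EReal) := by
  rw [integral_eq_lintegral_pos_part_sub_lintegral_neg_part hw]
  have h1 := hw.lintegral_lt_top
  have h2 : ∫⁻ t, ENNReal.ofReal (-w (unitCirc t)) ∂circParam < ⊤ := hw.neg.lintegral_lt_top
  rw [EReal.coe_sub, EReal.coe_ennreal_toReal h1.ne, EReal.coe_ennreal_toReal h2.ne]
  simp only [circleMean, ← EReal.coe_neg, EReal.toENNReal_of_ne_top (EReal.coe_ne_top _),
    EReal.toReal_coe]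
  rfl

lemma circleMean_congr {v w : ℂ → EReal} (h : ∀ ζ, ‖ζ‖ = 1 → v ζ = w ζ) :
    circleMean v = circleMean w := by
  have (t : ℝ) : v (unitCirc t) = w (unitCirc t) := h _ (norm_unitCirc t)
  unfold unitCirc at this
  simp only [circleMean, this]

lemma integral_re_unitCirc {f : ℂ → ℂ} (hf : Differentiable ℂ f) :
    ∫ t, (f (unitCirc t)).re ∂circParam = (f 0).re := by
  rw [← circleAverage_eq_integral_unitCirc (fun z => (f z).re)]
  have h1 : Real.circleAverage f 0 1 = f 0 :=
    circleAverage_of_differentiable_on_off_countable countable_empty hf.continuous.continuousOn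
      fun z _ => hf z
  have := Complex.reCLM.circleAverage_comp_comm (f := f) (c := 0) (R := 1)
    hf.continuous.continuousOn.circleIntegrable'
  rw [h1] at this
  exact this

/-- A continuous function on the circle is uniformly approximated by real parts of
entire functions. -/
lemma exists_entire_re_near {u : ℂ → ℝ} (hu : ContinuousOn u (Metric.sphere 0 1)) {ε : ℝ}
    (hε : 0 < ε) :
    ∃ f : ℂ → ℂ, Differentiable ℂ f ∧ ∀ ζ, ‖ζ‖ = 1 → |u ζ - (f ζ).re| < ε := by
  have : Fact (0 < (1 : ℝ)) := ⟨one_pos⟩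
  let U : C(AddCircle (1 : ℝ), ℂ) :=
    ⟨fun x => ((u (AddCircle.toCircle x : ℂ) : ℝ) : ℂ), by
      refine Complex.continuous_ofReal.comp (hu.comp_continuous ?_ ?_)
      · exact continuous_subtype_val.comp AddCircle.continuous_toCircle
      · intro x; simp [Circle.norm_coe]⟩
  have hU : U ∈ closure (Submodule.span ℂ (range <| @fourier 1) : Set C(AddCircle (1 : ℝ), ℂ)) := by
    rw [← Submodule.topologicalClosure_coe, span_fourier_closure_eq_top]; trivial
  obtain ⟨p, hp, hpU⟩ := Metric.mem_closure_iff.1 hU ε hε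
  -- On the circle, negative frequencies are conjugates of powers of `ζ`; since `f + conj g` and `f
  -- + g` have the same real part, `f + g` is the required entire function.
  have key : ∃ f g : ℂ → ℂ, Differentiable ℂ f ∧ Differentiable ℂ g ∧
      ∀ x : AddCircle (1 : ℝ), p x = f (AddCircle.toCircle x : ℂ) +
        (starRingEnd ℂ) (g (AddCircle.toCircle x : ℂ)) := by
    clear hpU
    induction hp using Submodule.span_induction with
    | mem p hp =>
      obtain ⟨n, rfl⟩ := hp
      rcases Int.eq_nat_or_neg n with ⟨m, rfl | rfl⟩
      · exact ⟨fun z => z ^ m, 0, by fun_prop, differentiable_const 0, fun x => by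
          simp [fourier_apply, AddCircle.toCircle_nsmul]⟩
      · exact ⟨0, fun z => z ^ m, differentiable_const 0, by fun_prop, fun x => by
          rw [fourier_neg, fourier_apply]; simp [AddCircle.toCircle_nsmul]⟩
    | zero => exact ⟨0, 0, differentiable_const 0, differentiable_const 0, fun x => by simp⟩
    | add p q _ _ hp hq =>
      obtain ⟨f, g, hf, hg, h⟩ := hp
      obtain ⟨f', g', hf', hg', h'⟩ := hq
      exact ⟨f + f', g + g', hf.add hf', hg.add hg', fun x => by simp [h, h']; ring⟩
    | smul c p _ hp =>
      obtain ⟨f, g, hf, hg, h⟩ := hp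
      exact ⟨c • f, (starRingEnd ℂ c) • g, hf.const_smul _, hg.const_smul _,
        fun x => by simp [h]; ring⟩
  obtain ⟨f, g, hf, hg, h⟩ := key
  refine ⟨f + g, hf.add hg, fun ζ hζ => ?_⟩
  obtain ⟨x, hx⟩ : ∃ x : AddCircle (1 : ℝ), (AddCircle.toCircle x : ℂ) = ζ := by
    obtain ⟨x, hx⟩ := (AddCircle.homeomorphCircle (T := 1) one_ne_zero).surjective
      ⟨ζ, by simpa [Submonoid.unitSphere] using hζ⟩
    refine ⟨x, ?_⟩
    rw [← AddCircle.homeomorphCircle_apply one_ne_zero, hx]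
  have h1 : dist (U x) (p x) < ε := (ContinuousMap.dist_apply_le_dist x).trans_lt hpU
  have h2 : u ζ - ((f + g) ζ).re = (U x - p x).re := by
    simp [U, h x, hx]
  rw [h2]
  exact (Complex.abs_re_le_norm _).trans_lt (by rwa [← dist_eq_norm])

/-! ### The function ψ -/

/-- A sequence of normalized linear forms on `ℂ²` whose zero lines have dense union. -/
noncomputable def denseForm (j : ℕ) (z : Cn 2) : ℂ :=
  (z 0 - TopologicalSpace.denseSeq ℂ j * z 1) / ((1 + ‖TopologicalSpace.denseSeq ℂ j‖ : ℝ) : ℂ)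

/-- Exponents for the forms `denseForm`, small enough for the weighted product to converge at
`(1, 0)`. -/
noncomputable def formWeight (j : ℕ) : ℝ :=
  (1 / 2) ^ (j + 2) / (1 + Real.log (1 + ‖TopologicalSpace.denseSeq ℂ j‖))

/-- Partial sums of the exponents. -/
noncomputable def weightSum (N : ℕ) : ℝ := ∑ j ∈ Finset.range N, formWeight j

/-- Homogenized partial products `‖z‖ ^ (1 - s) ∏ |lⱼ z| ^ cⱼ`. -/
noncomputable def psiPartial (N : ℕ) (z : Cn 2) : ℝ :=
  ‖z‖ ^ (1 - weightSum N) * ∏ j ∈ Finset.range N, ‖denseForm j z‖ ^ formWeight j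

/-- The infinite product of the `|lⱼ| ^ cⱼ`, homogenized. -/
noncomputable def psiProd (z : Cn 2) : ℝ := ⨅ N, psiPartial N z

lemma log_one_add_norm_nonneg (a : ℂ) : 0 ≤ Real.log (1 + ‖a‖) :=
  Real.log_nonneg (by linarith [norm_nonneg a])

lemma formWeight_pos (j : ℕ) : 0 < formWeight j := by
  have := log_one_add_norm_nonneg (TopologicalSpace.denseSeq ℂ j)
  unfold formWeight; positivity

lemma weightSum_le (N : ℕ) : weightSum N ≤ 1 / 2 - (1 / 2) ^ (N + 1) := by
  induction N with
  | zero => simp [weightSum]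
  | succ n ih =>
    have h : formWeight n ≤ (1 / 2) ^ (n + 2) :=
      div_le_self (by positivity)
        (by linarith [log_one_add_norm_nonneg (TopologicalSpace.denseSeq ℂ n)])
    have h2 : weightSum (n + 1) = weightSum n + formWeight n := Finset.sum_range_succ _ _
    rw [h2]
    have h3 : ((1 : ℝ) / 2) ^ (n + 1) = 2 * (1 / 2) ^ (n + 2) := by ring
    have h4 : ((1 : ℝ) / 2) ^ (n + 1 + 1) = (1 / 2) ^ (n + 2) := by ring
    linarith

lemma weightSum_lt_one (N : ℕ) : 0 < 1 - weightSum N := by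
  have h := weightSum_le N
  have : (0 : ℝ) < (1 / 2) ^ (N + 1) := by positivity
  linarith

lemma norm_denseForm_le (j : ℕ) (z : Cn 2) : ‖denseForm j z‖ ≤ ‖z‖ := by
  have h0 : ‖z 0‖ ≤ ‖z‖ := PiLp.norm_apply_le z 0
  have h1 : ‖z 1‖ ≤ ‖z‖ := PiLp.norm_apply_le z 1
  have hp : 0 < 1 + ‖TopologicalSpace.denseSeq ℂ j‖ := by positivity
  rw [denseForm, norm_div, Complex.norm_real, Real.norm_of_nonneg hp.le, div_le_iff₀ hp]
  calc _ ≤ ‖z 0‖ + ‖TopologicalSpace.denseSeq ℂ j * z 1‖ := norm_sub_le _ _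
    _ ≤ ‖z‖ + ‖TopologicalSpace.denseSeq ℂ j‖ * ‖z‖ := by rw [norm_mul]; gcongr
    _ = _ := by ring

lemma denseForm_smul (j : ℕ) (c : ℂ) (z : Cn 2) :
    denseForm j (c • z) = c * denseForm j z := by
  simp only [denseForm, PiLp.smul_apply, smul_eq_mul]; ring

lemma differentiable_denseForm (j : ℕ) {g : ℂ → Cn 2} (hg : Differentiable ℂ g) :
    Differentiable ℂ fun ζ => denseForm j (g ζ) := by
  unfold denseForm
  have h (i : Fin 2) : Differentiable ℂ fun ζ => (g ζ) i :=
    (EuclideanSpace.proj (𝕜 := ℂ) i).differentiable.comp hg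
  exact ((h 0).sub ((h 1).const_mul _)).div_const _

lemma continuous_denseForm (j : ℕ) : Continuous (denseForm j) := by
  unfold denseForm
  have h (i : Fin 2) : Continuous fun z : Cn 2 => z i :=
    (EuclideanSpace.proj (𝕜 := ℂ) i).continuous
  exact ((h 0).sub (continuous_const.mul (h 1))).div_const _

lemma psiPartial_nonneg (N : ℕ) (z : Cn 2) : 0 ≤ psiPartial N z :=
  mul_nonneg (by positivity) (Finset.prod_nonneg fun _ _ => by positivity)

lemma continuous_psiPartial (N : ℕ) : Continuous (psiPartial N) :=
  (continuous_norm.rpow_const fun _ => Or.inr (weightSum_lt_one N).le).mul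
    (continuous_finsetProd _ fun j _ =>
      (continuous_denseForm j).norm.rpow_const fun _ => Or.inr (formWeight_pos j).le)

/-- Passing to `N + 1` trades the factor `‖z‖ ^ cₙ` for `|lₙ z| ^ cₙ`, with `n = N`, which is no
larger. -/
lemma psiPartial_succ_le (N : ℕ) (z : Cn 2) : psiPartial (N + 1) z ≤ psiPartial N z := by
  have h2 : weightSum (N + 1) = weightSum N + formWeight N := Finset.sum_range_succ _ _
  have h3 := weightSum_lt_one (N + 1)
  rw [psiPartial, psiPartial, Finset.prod_range_succ, mul_comm (∏ j ∈ _, _), ← mul_assoc]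
  refine mul_le_mul_of_nonneg_right ?_ (Finset.prod_nonneg fun _ _ => by positivity)
  calc _ ≤ ‖z‖ ^ (1 - weightSum (N + 1)) * ‖z‖ ^ formWeight N := by
        have := norm_denseForm_le N z
        have := (formWeight_pos N).le
        gcongr
    _ = _ := by
        rw [← Real.rpow_add_of_nonneg (norm_nonneg z) h3.le (formWeight_pos N).le, h2]
        congr 1; ring

lemma antitone_psiPartial (z : Cn 2) : Antitone fun N => psiPartial N z :=
  antitone_nat_of_succ_le fun N => psiPartial_succ_le N z

lemma bddBelow_psiPartial (z : Cn 2) : BddBelow (range fun N => psiPartial N z) :=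
  ⟨0, by rintro _ ⟨N, rfl⟩; exact psiPartial_nonneg N z⟩

lemma psiPartial_le_norm (N : ℕ) (z : Cn 2) : psiPartial N z ≤ ‖z‖ := by
  refine (antitone_psiPartial z (Nat.zero_le N)).trans_eq ?_
  simp [psiPartial, weightSum]

lemma psiProd_nonneg (z : Cn 2) : 0 ≤ psiProd z := le_ciInf fun N => psiPartial_nonneg N z

lemma psiProd_le_psiPartial (N : ℕ) (z : Cn 2) : psiProd z ≤ psiPartial N z :=
  ciInf_le (bddBelow_psiPartial z) N

lemma psiProd_le_norm (z : Cn 2) : psiProd z ≤ ‖z‖ :=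
  (psiProd_le_psiPartial 0 z).trans (psiPartial_le_norm 0 z)

lemma tendsto_psiPartial (z : Cn 2) :
    Tendsto (fun N => psiPartial N z) atTop (𝓝 (psiProd z)) :=
  tendsto_atTop_ciInf (antitone_psiPartial z) (bddBelow_psiPartial z)

lemma psiPartial_smul (N : ℕ) (c : ℂ) (z : Cn 2) :
    psiPartial N (c • z) = ‖c‖ * psiPartial N z := by
  rcases eq_or_ne c 0 with rfl | hc
  -- The exponent `1 - weightSum N` is strictly positive, so the norm factor vanishes at the origin.
  · simp [psiPartial, Real.zero_rpow (weightSum_lt_one N).ne']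
  have hc' : 0 < ‖c‖ := norm_pos_iff.2 hc
  have h1 : ∏ j ∈ Finset.range N, ‖denseForm j (c • z)‖ ^ formWeight j =
      ‖c‖ ^ weightSum N * ∏ j ∈ Finset.range N, ‖denseForm j z‖ ^ formWeight j := by
    rw [weightSum, Real.rpow_sum_of_pos hc', ← Finset.prod_mul_distrib]
    refine Finset.prod_congr rfl fun j _ => ?_
    rw [denseForm_smul, norm_mul, Real.mul_rpow hc'.le (norm_nonneg _)]
  rw [psiPartial, psiPartial, h1, norm_smul, Real.mul_rpow hc'.le (norm_nonneg _)]
  have h2 : ‖c‖ ^ (1 - weightSum N) * ‖c‖ ^ weightSum N = ‖c‖ := by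
    rw [← Real.rpow_add hc', sub_add_cancel, Real.rpow_one]
  linear_combination (‖z‖ ^ (1 - weightSum N) *
    ∏ j ∈ Finset.range N, ‖denseForm j z‖ ^ formWeight j) * h2

lemma psiProd_smul (c : ℂ) (z : Cn 2) : psiProd (c • z) = ‖c‖ * psiProd z := by
  simp only [psiProd, psiPartial_smul, Real.mul_iInf_of_nonneg (norm_nonneg c)]

lemma upperSemicontinuous_psiProd : UpperSemicontinuous psiProd :=
  upperSemicontinuous_ciInf bddBelow_psiPartial
    fun N => (continuous_psiPartial N).upperSemicontinuous

/-- The factor `‖g‖` is not the modulus of a holomorphic function, so it is replaced by `|⟨e, g⟩|`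
with `e = g 0 / ‖g 0‖`: this agrees with `‖g‖` at 0 and is at most `‖g‖` elsewhere. -/
lemma psiPartial_le_integral (N : ℕ) {g : ℂ → Cn 2} (hg : Differentiable ℂ g) :
    psiPartial N (g 0) ≤ ∫ t, psiPartial N (g (unitCirc t)) ∂circParam := by
  rcases eq_or_ne (g 0) 0 with h0 | h0
  · have : psiPartial N (g 0) = 0 := by
      simp [psiPartial, h0, Real.zero_rpow (weightSum_lt_one N).ne']
    rw [this]
    exact integral_nonneg fun t => psiPartial_nonneg N _
  have hn : ‖g 0‖ ≠ 0 := norm_ne_zero_iff.2 h0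
  let e : Cn 2 := ((‖g 0‖ : ℂ)⁻¹) • g 0
  have he : ‖e‖ = 1 := by simp [e, norm_smul, hn]
  have he0 : inner ℂ e (g 0) = (‖g 0‖ : ℂ) := by
    simp only [e, inner_smul_left, inner_self_eq_norm_sq_to_K]
    simp; field_simp
  let f : ℕ → ℂ → ℂ := fun i ζ => if i < N then denseForm i (g ζ) else inner ℂ e (g ζ)
  let c : ℕ → ℝ := fun i => if i < N then formWeight i else 1 - weightSum N
  have hprod (ζ : ℂ) : ∏ i ∈ Finset.range (N + 1), ‖f i ζ‖ ^ c i =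
      ‖inner ℂ e (g ζ)‖ ^ (1 - weightSum N) *
        ∏ j ∈ Finset.range N, ‖denseForm j (g ζ)‖ ^ formWeight j := by
    rw [Finset.prod_range_succ, mul_comm]
    congr 1
    · simp [f, c]
    · refine Finset.prod_congr rfl fun i hi => ?_
      simp [f, c, Finset.mem_range.1 hi]
  have hinner : Differentiable ℂ fun ζ => inner ℂ e (g ζ) :=
    (innerSL ℂ e).differentiable.comp hg
  have hf : ∀ i ∈ Finset.range (N + 1), Differentiable ℂ (f i) := by
    intro i _
    by_cases hi : i < N
    · simpa [f, hi] using differentiable_denseForm i hg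
    · simpa [f, hi] using hinner
  have hc : ∀ i ∈ Finset.range (N + 1), 0 < c i := by
    intro i _
    by_cases hi : i < N
    · simpa [c, hi] using formWeight_pos i
    · simpa [c, hi] using weightSum_lt_one N
  have key := prod_rpow_le_integral (Finset.range (N + 1)) hf hc
  simp only [hprod] at key
  rw [he0, Complex.norm_real, norm_norm] at key
  refine key.trans (integral_mono ?_ ?_ fun t => ?_)
  · refine integrable_of_continuous_circParam ?_
    refine ((hinner.continuous.comp continuous_unitCirc).norm.rpow_const
      fun _ => Or.inr (weightSum_lt_one N).le).mul (continuous_finsetProd _ fun j _ =>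
      ((continuous_denseForm j).comp (hg.continuous.comp continuous_unitCirc)).norm.rpow_const
        fun _ => Or.inr (formWeight_pos j).le)
  · exact integrable_of_continuous_circParam
      ((continuous_psiPartial N).comp (hg.continuous.comp continuous_unitCirc))
  · refine mul_le_mul_of_nonneg_right ?_ (Finset.prod_nonneg fun _ _ => by positivity)
    refine Real.rpow_le_rpow (norm_nonneg _) ?_ (weightSum_lt_one N).le
    simpa [he] using norm_inner_le_norm (𝕜 := ℂ) e (g (unitCirc t))

lemma integrable_psiProd_comp {g : ℂ → Cn 2} (hg : Continuous g) :
    Integrable (fun t => psiProd (g (unitCirc t))) circParam := by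
  have hgc := hg.comp continuous_unitCirc
  refine (integrable_of_continuous_circParam hgc.norm).mono' ?_ (ae_of_all _ fun t => ?_)
  · exact aestronglyMeasurable_of_tendsto_ae atTop
      (fun N => ((continuous_psiPartial N).comp hgc).aestronglyMeasurable)
      (ae_of_all _ fun t => tendsto_psiPartial _)
  · rw [Real.norm_of_nonneg (psiProd_nonneg _)]
    exact psiProd_le_norm _

lemma psiProd_le_integral {g : ℂ → Cn 2} (hg : Differentiable ℂ g) :
    psiProd (g 0) ≤ ∫ t, psiProd (g (unitCirc t)) ∂circParam := by
  have hgc := hg.continuous.comp continuous_unitCirc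
  have hlim : Tendsto (fun N => ∫ t, psiPartial N (g (unitCirc t)) ∂circParam) atTop
      (𝓝 (∫ t, psiProd (g (unitCirc t)) ∂circParam)) := by
    refine tendsto_integral_of_dominated_convergence (fun t => ‖g (unitCirc t)‖)
      (fun N => ((continuous_psiPartial N).comp hgc).aestronglyMeasurable)
      (integrable_of_continuous_circParam hgc.norm)
      (fun N => ae_of_all _ fun t => ?_) (ae_of_all _ fun t => tendsto_psiPartial _)
    rw [Real.norm_of_nonneg (psiPartial_nonneg _ _)]
    exact psiPartial_le_norm _ _
  exact ge_of_tendsto' hlim fun N =>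
    (psiProd_le_psiPartial N _).trans (psiPartial_le_integral N hg)

lemma isPSH_psiProd : IsPSH (fun z => (psiProd z : EReal)) univ := by
  refine ⟨?_, fun z _ => EReal.coe_ne_top _, fun a b _ => ?_⟩
  · rw [upperSemicontinuousOn_univ_iff]
    exact continuous_coe_real_ereal.comp_upperSemicontinuous upperSemicontinuous_psiProd
      EReal.coe_strictMono.monotone
  · have hg : Differentiable ℂ fun ζ : ℂ => a + ζ • b := by fun_prop
    rw [circleMean_coe_of_integrable (integrable_psiProd_comp hg.continuous)]
    have := psiProd_le_integral hg
    rw [zero_smul, add_zero] at this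
    exact EReal.coe_le_coe_iff.2 this

/-- The zero set contains every line `z 0 = aⱼ * z 1` with `aⱼ` from the dense sequence. These lines
are the image of a dense set under `(a, w) ↦ (a * w, w)`, whose range contains all points with `z 1
≠ 0`. -/
lemma dense_psiProd_eq_zero : Dense {z | psiProd z = 0} := by
  let Φ : ℂ × ℂ → Cn 2 := fun p => !₂[p.1 * p.2, p.2]
  have hΦ : Continuous Φ := by
    refine (PiLp.continuous_toLp 2 _).comp (continuous_pi fun i => ?_)
    fin_cases i
    · exact continuous_fst.mul continuous_snd
    · exact continuous_snd
  have hrange : DenseRange Φ := by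
    have hd : Dense {z : Cn 2 | z 1 ≠ 0} :=
      (dense_compl_singleton (0 : ℂ)).preimage (f := EuclideanSpace.proj (𝕜 := ℂ) (1 : Fin 2))
        ((EuclideanSpace.proj (𝕜 := ℂ) (1 : Fin 2)).isOpenMap
          fun w => ⟨!₂[0, w], by simp⟩)
    refine hd.mono fun z hz => ⟨(z 0 / z 1, z 1), ?_⟩
    ext i
    fin_cases i
    · simpa [Φ] using div_mul_cancel₀ _ hz
    · simp [Φ]
  have hA : Dense (range (TopologicalSpace.denseSeq ℂ) ×ˢ (univ : Set ℂ)) :=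
    (TopologicalSpace.denseRange_denseSeq ℂ).prod dense_univ
  refine (hrange.dense_image hΦ hA).mono ?_
  rintro _ ⟨⟨_, w⟩, ⟨⟨j, rfl⟩, -⟩, rfl⟩
  refine le_antisymm ((psiProd_le_psiPartial (j + 1) _).trans_eq ?_) (psiProd_nonneg _)
  refine mul_eq_zero_of_right _ (Finset.prod_eq_zero (Finset.self_mem_range_succ j) ?_)
  simp [denseForm, Φ, Real.zero_rpow (formWeight_pos j).ne']

/-- At `(1, 0)` the factors are `(1 + ‖aⱼ‖) ^ (-cⱼ)`, and the weights make `cⱼ * log (1 + ‖aⱼ‖) ≤ 2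
^ (-(j + 2))`; these bounds sum to 1/2, so every partial product is at least `exp (-1/2)`. -/
lemma psiProd_ne_zero : psiProd !₂[1, 0] ≠ 0 := by
  have hz : ‖(!₂[1, 0] : Cn 2)‖ = 1 := by simp [EuclideanSpace.norm_eq]
  have h (N : ℕ) : Real.exp (-(1 / 2)) ≤ psiPartial N !₂[1, 0] := by
    have hs : ∀ j, ‖denseForm j !₂[1, 0]‖ ^ formWeight j =
        Real.exp (-(formWeight j * Real.log (1 + ‖TopologicalSpace.denseSeq ℂ j‖))) := by
      intro j
      have hp : 0 < 1 + ‖TopologicalSpace.denseSeq ℂ j‖ := by positivity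
      have : ‖denseForm j !₂[1, 0]‖ = (1 + ‖TopologicalSpace.denseSeq ℂ j‖)⁻¹ := by
        simp only [denseForm, norm_div, Complex.norm_real, Real.norm_of_nonneg hp.le]
        simp
      rw [this, Real.rpow_def_of_pos (by positivity), Real.log_inv]
      congr 1; ring
    rw [psiPartial, hz, Real.one_rpow, one_mul, Finset.prod_congr rfl fun j _ => hs j,
      ← Real.exp_sum, Finset.sum_neg_distrib]
    refine Real.exp_le_exp.2 (neg_le_neg ?_)
    have hw : ∀ j, formWeight j * Real.log (1 + ‖TopologicalSpace.denseSeq ℂ j‖) ≤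
        (1 / 2) ^ (j + 2) := by
      intro j
      have := log_one_add_norm_nonneg (TopologicalSpace.denseSeq ℂ j)
      rw [formWeight, div_mul_eq_mul_div, div_le_iff₀ (by linarith)]
      exact mul_le_mul_of_nonneg_left (by linarith) (by positivity)
    refine (Finset.sum_le_sum fun j _ => hw j).trans ?_
    have : ∀ n : ℕ, ∑ j ∈ Finset.range n, ((1 : ℝ) / 2) ^ (j + 2) = 1 / 2 - (1 / 2) ^ (n + 1) := by
      intro n
      induction n with
      | zero => simp
      | succ n ih => rw [Finset.sum_range_succ, ih]; ring
    rw [this]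
    linarith [show (0 : ℝ) < (1 / 2) ^ (N + 1) by positivity]
  exact ((Real.exp_pos _).trans_le (le_ciInf h)).ne'

/-! ### The domain, the disc principle and pseudoconvexity -/

lemma norm_le_integral_norm {n : ℕ} {g : ℂ → Cn n} (hg : Differentiable ℂ g) :
    ‖g 0‖ ≤ ∫ t, ‖g (unitCirc t)‖ ∂circParam := by
  have h1 : Real.circleAverage g 0 1 = g 0 :=
    circleAverage_of_differentiable_on_off_countable countable_empty hg.continuous.continuousOn
      fun z _ => hg z
  rw [← h1, circleAverage_eq_integral_unitCirc]
  exact norm_integral_le_integral_norm _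

/-- The domain `‖z‖ + ψ(z) < 1`. -/
def psiDomain : Set (Cn 2) := {z | ‖z‖ + psiProd z < 1}

lemma upperSemicontinuous_norm_add_psiProd : UpperSemicontinuous fun z : Cn 2 => ‖z‖ + psiProd z :=
  continuous_norm.upperSemicontinuous.add upperSemicontinuous_psiProd

lemma isOpen_psiDomain : IsOpen psiDomain :=
  upperSemicontinuous_norm_add_psiProd.isOpen_preimage 1

/-- Upper semicontinuity makes `‖z‖ + ψ(z)` attain its maximum over the boundary circle of the disc.
That maximum is below 1 and bounds the mean, hence the value at the centre. -/
lemma apply_zero_mem_psiDomain {g : ℂ → Cn 2} (hg : Differentiable ℂ g)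
    (h : ∀ ζ, ‖ζ‖ = 1 → g ζ ∈ psiDomain) : g 0 ∈ psiDomain := by
  have husc : UpperSemicontinuousOn (fun ζ => ‖g ζ‖ + psiProd (g ζ)) (Metric.sphere (0 : ℂ) 1) :=
    (upperSemicontinuous_norm_add_psiProd.comp hg.continuous).upperSemicontinuousOn _
  obtain ⟨x, hx, hmax⟩ := husc.exists_isMaxOn (NormedSpace.sphere_nonempty.2 zero_le_one)
    (isCompact_sphere 0 1)
  have hi1 : Integrable (fun t => ‖g (unitCirc t)‖) circParam :=
    integrable_of_continuous_circParam (hg.continuous.comp continuous_unitCirc).norm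
  have hi2 := integrable_psiProd_comp hg.continuous
  have hle : ∫ t, (‖g (unitCirc t)‖ + psiProd (g (unitCirc t))) ∂circParam ≤
      ∫ _, (‖g x‖ + psiProd (g x)) ∂circParam := by
    refine integral_mono (hi1.add hi2) (integrable_const _) fun t => ?_
    exact hmax (by simp [norm_unitCirc])
  rw [integral_add hi1 hi2, integral_const] at hle
  simp only [probReal_univ, one_smul] at hle
  have hx' : ‖g x‖ + psiProd (g x) < 1 := h x (by simpa using hx)
  have h1 := norm_le_integral_norm hg
  have h2 := psiProd_le_integral hg
  change ‖g 0‖ + psiProd (g 0) < 1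
  linarith

/-- A proper open set satisfying the disc principle for entire discs is pseudoconvex. -/
lemma isPseudoconvex_of_entire_discs {n : ℕ} {D : Set (Cn n)} (hD : IsOpen D)
    (hne : Dᶜ.Nonempty)
    (hdisc : ∀ g : ℂ → Cn n, Differentiable ℂ g → (∀ ζ, ‖ζ‖ = 1 → g ζ ∈ D) → g 0 ∈ D) :
    IsPseudoconvex D := by
  have hpos : ∀ z ∈ D, 0 < Metric.infDist z Dᶜ := fun z hz =>
    (hD.isClosed_compl.notMem_iff_infDist_pos hne).1 (by simpa using hz)
  have hval : ∀ z ∈ D, -ENNReal.log (Metric.infEDist z Dᶜ) =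
      ((-Real.log (Metric.infDist z Dᶜ) : ℝ) : EReal) := by
    intro z hz
    have h1 : Metric.infEDist z Dᶜ = ENNReal.ofReal (Metric.infDist z Dᶜ) :=
      (ENNReal.ofReal_toReal (Metric.infEDist_ne_top hne)).symm
    rw [h1, ENNReal.log_ofReal_of_pos (hpos z hz), EReal.coe_neg]
  refine ⟨?_, fun z hz => (hval z hz).trans_ne (EReal.coe_ne_top _), fun a b hab => ?_⟩
  · refine Continuous.upperSemicontinuous ?_ |>.upperSemicontinuousOn _
    exact continuous_neg.comp (ENNReal.continuous_log.comp Metric.continuous_infEDist)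
  have ha : a ∈ D := by simpa using hab 0 (by simp)
  let u : ℂ → ℝ := fun ζ => -Real.log (Metric.infDist (a + ζ • b) Dᶜ)
  have hu : ContinuousOn u (Metric.sphere 0 1) := by
    refine (ContinuousOn.log ?_ fun ζ hζ => (hpos _ (hab ζ ?_)).ne').neg
    · exact ((Metric.continuous_infDist_pt _).comp (by fun_prop)).continuousOn
    · simpa using (mem_sphere_zero_iff_norm.1 hζ).le
  have huint : Integrable (fun t => u (unitCirc t)) circParam :=
    integrable_of_continuous_circParam
      (hu.comp_continuous continuous_unitCirc fun t => by simp [norm_unitCirc])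
  beta_reduce
  rw [hval a ha, circleMean_congr (w := fun ζ => (u ζ : EReal)) fun ζ hζ => hval _ (hab ζ hζ.le),
    circleMean_coe_of_integrable huint, EReal.coe_le_coe_iff]
  refine le_of_forall_pos_le_add fun ε hε => ?_
  obtain ⟨f₀, hf₀, hfu⟩ := exists_entire_re_near hu (half_pos hε)
  -- The shift by `ε / 2` puts `Re f` strictly between `u` and `u + ε` on the circle.
  let f : ℂ → ℂ := fun ζ => f₀ ζ + ((ε / 2 : ℝ) : ℂ)
  have hf : Differentiable ℂ f := hf₀.add_const _
  have hre (ζ : ℂ) : (f ζ).re = (f₀ ζ).re + ε / 2 := by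
    simp only [f, Complex.add_re, Complex.ofReal_re]
  have hmean : (f 0).re ≤ (∫ t, u (unitCirc t) ∂circParam) + ε := by
    rw [← integral_re_unitCirc hf]
    calc ∫ t, (f (unitCirc t)).re ∂circParam ≤ ∫ t, (u (unitCirc t) + ε) ∂circParam := by
          refine integral_mono (integrable_of_continuous_circParam (Complex.continuous_re.comp
            (hf.continuous.comp continuous_unitCirc))) (huint.add (integrable_const _)) fun t => ?_
          have := abs_lt.1 (hfu _ (norm_unitCirc t))
          simp only [hre]
          linarith [this.1]
      _ = _ := by rw [integral_add huint (integrable_const _), integral_const]; simp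
  refine le_trans ?_ hmean
  have hdist : Real.exp (-(f 0).re) ≤ Metric.infDist a Dᶜ := by
    refine (Metric.le_infDist hne).2 fun y hy => ?_
    by_contra hlt
    push Not at hlt
    refine hy ?_
    -- Chosen so that the disc `a + ζ • b + exp (-f ζ) • w` is centred at `y`. Since `‖w‖ < 1`, on
    -- the circle it moves `a + ζ • b` by less than its distance to the complement, so the disc
    -- principle forces `y ∈ D`.
    let w : Cn n := Complex.exp (f 0) • (y - a)
    have hw : ‖w‖ < 1 := by
      rw [norm_smul, Complex.norm_exp, ← dist_eq_norm, dist_comm]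
      calc _ < Real.exp (f 0).re * Real.exp (-(f 0).re) := by gcongr
        _ = 1 := by rw [← Real.exp_add]; simp
    have hg := hdisc (fun ζ => a + ζ • b + Complex.exp (-f ζ) • w) (by fun_prop) ?_
    · simpa [w, smul_smul, ← Complex.exp_add] using hg
    intro ζ hζ
    by_contra hmem
    have h1 : Metric.infDist (a + ζ • b) Dᶜ ≤ Real.exp (-(f ζ).re) * ‖w‖ := by
      refine (Metric.infDist_le_dist_of_mem hmem).trans_eq ?_
      rw [dist_self_add_right, norm_smul, Complex.norm_exp, Complex.neg_re]
    have h2 : u ζ < (f ζ).re := by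
      rw [hre]; linarith [(abs_lt.1 (hfu ζ hζ)).2]
    have h3 : Real.exp (-(f ζ).re) < Metric.infDist (a + ζ • b) Dᶜ := by
      rw [← Real.lt_log_iff_exp_lt (hpos _ (hab ζ hζ.le))]
      simp only [u] at h2
      linarith
    nlinarith [Real.exp_pos (-(f ζ).re)]
  have := Real.log_le_log (Real.exp_pos _) hdist
  rw [Real.log_exp] at this
  linarith

/-! ### Schwarz-Pick and the lower bound -/

lemma norm_one_sub_conj_mul_sq_sub (z w : ℂ) :
    ‖1 - (starRingEnd ℂ) z * w‖ ^ 2 - ‖w - z‖ ^ 2 = (1 - ‖z‖ ^ 2) * (1 - ‖w‖ ^ 2) := by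
  simp only [← Complex.normSq_eq_norm_sq, Complex.normSq_apply, Complex.sub_re, Complex.sub_im,
    Complex.mul_re, Complex.mul_im, Complex.conj_re, Complex.conj_im, Complex.one_re,
    Complex.one_im]
  ring

/-- The Schwarz-Pick lemma, in the form of a bound for the norm of the values. -/
lemma norm_le_of_mapsTo_unitDisc {F : ℂ → ℂ} (hd : DifferentiableOn ℂ F unitDisc)
    (hm : MapsTo F unitDisc unitDisc) {α : ℂ} (hα : α ∈ unitDisc) :
    ‖F α‖ * (1 + ‖F 0‖ * ‖α‖) ≤ ‖F 0‖ + ‖α‖ := by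
  have hlt : ∀ x ∈ unitDisc, ‖F x‖ < 1 := fun x hx => mem_ball_zero_iff.1 (hm hx)
  have h0 : ‖F 0‖ < 1 := hlt 0 (by simp [unitDisc])
  have hα1 : ‖α‖ < 1 := mem_ball_zero_iff.1 hα
  have hden_le : ∀ x ∈ unitDisc, 1 - ‖F 0‖ * ‖F x‖ ≤ ‖1 - (starRingEnd ℂ) (F 0) * F x‖ := by
    intro x _
    have := norm_sub_norm_le 1 ((starRingEnd ℂ) (F 0) * F x)
    simpa using this
  have hden_pos : ∀ x ∈ unitDisc, 0 < 1 - ‖F 0‖ * ‖F x‖ := by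
    intro x hx
    nlinarith [hlt x hx, norm_nonneg (F x), norm_nonneg (F 0)]
  have hden : ∀ x ∈ unitDisc, 1 - (starRingEnd ℂ) (F 0) * F x ≠ 0 := fun x hx =>
    norm_pos_iff.1 ((hden_pos x hx).trans_le (hden_le x hx))
  -- Schwarz's lemma for `F` followed by the disc automorphism that sends `F 0` to 0.
  have hG := Complex.norm_le_norm_of_mapsTo_ball (R := 1) (z := α)
    (f := fun x => (F x - F 0) / (1 - (starRingEnd ℂ) (F 0) * F x))
    ((hd.sub_const _).div ((hd.const_mul _).const_sub _) hden) ?_ (by simp) hα1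
  swap
  · intro x hx
    rw [mem_closedBall_zero_iff, norm_div]
    refine div_le_one_of_le₀ ((sq_le_sq₀ (norm_nonneg _) (norm_nonneg _)).1 ?_) (norm_nonneg _)
    have h1 := norm_one_sub_conj_mul_sq_sub (F 0) (F x)
    have h2 : 0 ≤ (1 - ‖F 0‖ ^ 2) * (1 - ‖F x‖ ^ 2) := by
      have := hlt x hx
      refine mul_nonneg ?_ ?_ <;> nlinarith [norm_nonneg (F x), norm_nonneg (F 0)]
    linarith
  rw [norm_div, div_le_iff₀ (norm_pos_iff.2 (hden α hα))] at hG
  have hG2 : ‖F α - F 0‖ ^ 2 ≤ ‖α‖ ^ 2 * ‖1 - (starRingEnd ℂ) (F 0) * F α‖ ^ 2 := by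
    rw [← mul_pow]; gcongr
  have h1 := norm_one_sub_conj_mul_sq_sub (F 0) (F α)
  have h3 : (1 - ‖F 0‖ * ‖F α‖) ^ 2 ≤ ‖1 - (starRingEnd ℂ) (F 0) * F α‖ ^ 2 := by
    have := (hden_pos α hα).le
    have := hden_le α hα
    gcongr
  -- The identity gives `(1 - ‖α‖²) * ‖1 - conj (F 0) * F α‖² ≤ (1 - ‖F 0‖²) * (1 - ‖F α‖²)`; the
  -- left side only shrinks when the moduli replace the complex values, and the same identity for
  -- the moduli gives the claim.
  have h4 : (‖F α‖ - ‖F 0‖) ^ 2 ≤ (‖α‖ * (1 - ‖F 0‖ * ‖F α‖)) ^ 2 := by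
    have h5 : 0 ≤ 1 - ‖α‖ ^ 2 := by nlinarith [norm_nonneg α]
    nlinarith [mul_le_mul_of_nonneg_left h3 h5]
  have h6 := abs_le_of_sq_le_sq h4 (mul_nonneg (norm_nonneg _) (hden_pos α hα).le)
  nlinarith [(abs_le.1 h6).2]

lemma artanh_le_artanh_add {s r W : ℝ} (hs0 : 0 ≤ s) (hs : s < 1) (hr0 : 0 ≤ r) (hr : r < 1)
    (hW0 : 0 ≤ W) (hW : W < 1) (h : W * (1 + s * r) ≤ s + r) :
    Real.artanh W ≤ Real.artanh s + Real.artanh r := by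
  rw [Real.artanh_eq_half_log ⟨by linarith, hW.le⟩, Real.artanh_eq_half_log ⟨by linarith, hs.le⟩,
    Real.artanh_eq_half_log ⟨by linarith, hr.le⟩, ← mul_add]
  have h1 : 0 < 1 - W := by linarith
  have h2 : 0 < 1 - s := by linarith
  have h3 : 0 < 1 - r := by linarith
  rw [← Real.log_mul (by positivity) (by positivity)]
  gcongr
  rw [div_mul_div_comm, div_le_div_iff₀ h1 (by positivity)]
  nlinarith

lemma artanh_norm_le_of_mapsTo_unitDisc {F : ℂ → ℂ} (hd : DifferentiableOn ℂ F unitDisc)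
    (hm : MapsTo F unitDisc unitDisc) {α : ℂ} (hα : α ∈ unitDisc) :
    Real.artanh ‖F α‖ ≤ Real.artanh ‖F 0‖ + Real.artanh ‖α‖ :=
  artanh_le_artanh_add (norm_nonneg _) (mem_ball_zero_iff.1 (hm (by simp [unitDisc])))
    (norm_nonneg _) (mem_ball_zero_iff.1 hα) (norm_nonneg _) (mem_ball_zero_iff.1 (hm hα))
    (norm_le_of_mapsTo_unitDisc hd hm hα)

/-- The form `⟨e, ·⟩` maps D into the unit disc, so Schwarz-Pick applies to its composition with
each competing disc. -/
lemma artanh_norm_inner_le_add_lempert {n : ℕ} {D : Set (Cn n)} (hD : D ⊆ Metric.ball 0 1)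
    {e : Cn n} (he : ‖e‖ ≤ 1) (z w : Cn n) :
    ENNReal.ofReal (Real.artanh ‖inner ℂ e w‖) ≤
      ENNReal.ofReal (Real.artanh ‖inner ℂ e z‖) + lempert D z w := by
  rw [← tsub_le_iff_left]
  refine le_sInf ?_
  rintro _ ⟨φ, ⟨hφd, hφm⟩, α, hα, rfl, rfl, rfl⟩
  rw [tsub_le_iff_left, ← ENNReal.ofReal_add (Real.artanh_nonneg (norm_nonneg _))
    (Real.artanh_nonneg (norm_nonneg _))]
  refine ENNReal.ofReal_le_ofReal
    (artanh_norm_le_of_mapsTo_unitDisc (F := fun x => inner ℂ e (φ x)) ?_ ?_ hα)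
  · exact (innerSL ℂ e).differentiable.comp_differentiableOn hφd
  · intro x hx
    refine mem_ball_zero_iff.2 ((norm_inner_le_norm e (φ x)).trans_lt ?_)
    have := mem_ball_zero_iff.1 (hD (hφm hx))
    nlinarith [norm_nonneg e, norm_nonneg (φ x)]

lemma artanh_norm_le_lempertChain {n : ℕ} {D : Set (Cn n)} (hD : D ⊆ Metric.ball 0 1)
    (a : Cn n) : ENNReal.ofReal (Real.artanh ‖a‖) ≤ lempertChain D 2 0 a := by
  refine le_sInf ?_
  rintro _ ⟨p, -, h0, h2, rfl⟩
  -- For `a = 0` this is 0, which is why only `‖e‖ ≤ 1` is asked for.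
  let e : Cn n := ((‖a‖ : ℂ)⁻¹) • a
  have he : ‖e‖ ≤ 1 := by
    simp only [e, norm_smul, norm_inv, Complex.norm_real, norm_norm]
    exact inv_mul_le_one
  have hea : ‖inner ℂ e a‖ = ‖a‖ := by
    rcases eq_or_ne a 0 with rfl | ha
    · simp
    · have : ‖a‖ ≠ 0 := norm_ne_zero_iff.2 ha
      simp only [e, inner_smul_left, inner_self_eq_norm_sq_to_K, norm_mul, norm_pow]
      simp; field_simp
  have h1 := artanh_norm_inner_le_add_lempert hD he (p 0) (p 1)
  have h2' := artanh_norm_inner_le_add_lempert hD he (p 1) (p 2)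
  have hp2 : p 2 = a := h2
  rw [h0, inner_zero_right, norm_zero, Real.artanh_zero, ENNReal.ofReal_zero, zero_add] at h1
  rw [hp2, hea] at h2'
  rw [Fin.sum_univ_two]
  change _ ≤ lempert D (p 0) (p 1) + lempert D (p 1) (p 2)
  rw [h0, hp2]
  exact h2'.trans (by gcongr)

/-! ### The upper bound -/

lemma lempert_le_of_ball_subset {n : ℕ} {D : Set (Cn n)} {z w : Cn n} {r : ℝ}
    (hball : Metric.ball z r ⊆ D) (hw : ‖w - z‖ < r) :
    lempert D z w ≤ ENNReal.ofReal (Real.artanh (‖w - z‖ / r)) := by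
  have hr : 0 < r := (norm_nonneg _).trans_lt hw
  refine sInf_le ⟨fun ζ => z + ζ • (((r / ‖w - z‖ : ℝ) : ℂ) • (w - z)), ⟨?_, ?_⟩,
    ((‖w - z‖ / r : ℝ) : ℂ), ?_, by simp, ?_, ?_⟩
  · exact Differentiable.differentiableOn (by fun_prop)
  · intro ζ hζ
    have hζ' : ‖ζ‖ < 1 := mem_ball_zero_iff.1 hζ
    refine hball ?_
    rw [mem_ball_iff_norm, add_sub_cancel_left, norm_smul, norm_smul, Complex.norm_real,
      Real.norm_of_nonneg (by positivity)]
    have h1 : r / ‖w - z‖ * ‖w - z‖ ≤ r := by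
      rw [div_mul_eq_mul_div]
      exact div_le_of_le_mul₀ (norm_nonneg _) hr.le le_rfl
    nlinarith [norm_nonneg ζ]
  · rw [unitDisc, mem_ball_zero_iff, Complex.norm_real, Real.norm_of_nonneg (by positivity)]
    exact (div_lt_one hr).2 hw
  · rcases eq_or_ne w z with rfl | hne
    · simp
    · have : ‖w - z‖ ≠ 0 := norm_ne_zero_iff.2 (sub_ne_zero.2 hne)
      beta_reduce
      rw [smul_smul, ← Complex.ofReal_mul, div_mul_div_cancel₀ hr.ne', div_self this]
      simp
  · rw [Complex.norm_real, Real.norm_of_nonneg (by positivity)]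

lemma psiDomain_subset_ball : psiDomain ⊆ Metric.ball 0 1 := by
  intro z hz
  have hz' : ‖z‖ + psiProd z < 1 := hz
  rw [mem_ball_zero_iff]
  linarith [psiProd_nonneg z]

lemma mem_psiDomain_of_eq_zero {z : Cn 2} (hz : psiProd z = 0) (h : ‖z‖ < 1) : z ∈ psiDomain := by
  change ‖z‖ + psiProd z < 1
  rwa [hz, add_zero]

/-- By homogeneity ψ vanishes on the whole complex line through `z`, so the radial unit disc in that
line lies in D. -/
lemma lempert_psiDomain_zero_le {z : Cn 2} (hz : psiProd z = 0) (h : ‖z‖ < 1) :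
    lempert psiDomain 0 z ≤ ENNReal.ofReal (Real.artanh ‖z‖) := by
  refine sInf_le ⟨fun ζ => ζ • (((‖z‖⁻¹ : ℝ) : ℂ) • z), ⟨?_, ?_⟩, (‖z‖ : ℂ), ?_, by simp,
    ?_, by simp⟩
  · exact Differentiable.differentiableOn (by fun_prop)
  · intro ζ hζ
    have hζ' : ‖ζ‖ < 1 := mem_ball_zero_iff.1 hζ
    refine mem_psiDomain_of_eq_zero (by simp [psiProd_smul, hz]) ?_
    rw [norm_smul, norm_smul, Complex.norm_real, norm_inv, norm_norm]
    have h1 : ‖z‖⁻¹ * ‖z‖ ≤ 1 := inv_mul_le_one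
    nlinarith [norm_nonneg ζ]
  · simpa [unitDisc] using h
  · rcases eq_or_ne z 0 with rfl | hne
    · simp
    · have : ‖z‖ ≠ 0 := norm_ne_zero_iff.2 hne
      beta_reduce
      rw [smul_smul, ← Complex.ofReal_mul, mul_inv_cancel₀ this]
      simp

lemma continuousAt_artanh {x : ℝ} (hx : x ∈ Ioo (-1) 1) : ContinuousAt Real.artanh x := by
  have h : (fun y => 1 / 2 * Real.log ((1 + y) / (1 - y))) =ᶠ[𝓝 x] Real.artanh := by
    filter_upwards [Ioo_mem_nhds hx.1 hx.2] with y hy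
    exact (Real.artanh_eq_half_log (Ioo_subset_Icc_self hy)).symm
  refine ContinuousAt.congr ?_ h
  have h1 : 1 - x ≠ 0 := by linarith [hx.2]
  have h2 : 1 + x ≠ 0 := by linarith [hx.1]
  refine continuousAt_const.mul (ContinuousAt.log ?_ (div_ne_zero h2 h1))
  exact ContinuousAt.div (by fun_prop) (by fun_prop) h1

/-- Let the intermediate point `z` tend to `a` within the zero set of ψ: the first step costs at
most `artanh ‖z‖` and the cost of the second tends to 0. The radius `r / 2` serves for all `z`
within `r / 2` of `a`. -/
lemma lempertChain_psiDomain_le {a : Cn 2} (ha : a ∈ psiDomain) :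
    lempertChain psiDomain 2 0 a ≤ ENNReal.ofReal (Real.artanh ‖a‖) := by
  obtain ⟨r, hr, hball⟩ := Metric.isOpen_iff.1 isOpen_psiDomain a ha
  have ha1 : ‖a‖ < 1 := mem_ball_zero_iff.1 (psiDomain_subset_ball ha)
  have : (𝓝[{z | psiProd z = 0}] a).NeBot :=
    mem_closure_iff_nhdsWithin_neBot.1 (dense_psiProd_eq_zero a)
  have hlim : Tendsto (fun z => ENNReal.ofReal (Real.artanh ‖z‖) +
      ENNReal.ofReal (Real.artanh (‖a - z‖ / (r / 2)))) (𝓝[{z | psiProd z = 0}] a)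
      (𝓝 (ENNReal.ofReal (Real.artanh ‖a‖))) := by
    refine Tendsto.mono_left ?_ nhdsWithin_le_nhds
    have h1 : Tendsto (fun z : Cn 2 => ENNReal.ofReal (Real.artanh ‖z‖)) (𝓝 a)
        (𝓝 (ENNReal.ofReal (Real.artanh ‖a‖))) :=
      ENNReal.tendsto_ofReal ((continuousAt_artanh
        ⟨by linarith [norm_nonneg a], ha1⟩).tendsto.comp continuous_norm.continuousAt)
    have h2 : Tendsto (fun z : Cn 2 => ENNReal.ofReal (Real.artanh (‖a - z‖ / (r / 2)))) (𝓝 a)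
        (𝓝 (ENNReal.ofReal (Real.artanh 0))) := by
      refine ENNReal.tendsto_ofReal ((continuousAt_artanh (by simp)).tendsto.comp ?_)
      have : Continuous fun z : Cn 2 => ‖a - z‖ / (r / 2) := by fun_prop
      simpa using this.tendsto a
    simpa using h1.add h2
  refine ge_of_tendsto hlim ?_
  filter_upwards [self_mem_nhdsWithin,
    mem_nhdsWithin_of_mem_nhds (Metric.ball_mem_nhds a (half_pos hr))] with z hz hza
  have hza' : dist z a < r / 2 := hza
  have hzD : z ∈ psiDomain := hball (Metric.ball_subset_ball (by linarith) hza)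
  have hz1 : ‖z‖ < 1 := mem_ball_zero_iff.1 (psiDomain_subset_ball hzD)
  have h0 : psiProd 0 = 0 := by simpa using psiProd_smul 0 0
  calc lempertChain psiDomain 2 0 a ≤ lempert psiDomain 0 z + lempert psiDomain z a := by
        refine sInf_le ⟨![0, z, a], ?_, rfl, rfl, ?_⟩
        · intro j
          fin_cases j
          · exact mem_psiDomain_of_eq_zero h0 (by simp)
          · exact hzD
          · exact ha
        · rw [Fin.sum_univ_two]; rfl
    _ ≤ _ := by
        refine add_le_add (lempert_psiDomain_zero_le hz hz1) (lempert_le_of_ball_subset ?_ ?_)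
        · refine (Metric.ball_subset_ball' ?_).trans hball
          linarith
        · rwa [← dist_eq_norm, dist_comm]

/-! ### Balancedness, tautness and convex hull -/

lemma balanced_psiDomain : Balanced ℂ psiDomain := by
  rintro c hc _ ⟨z, hz, rfl⟩
  have hz' : ‖z‖ + psiProd z < 1 := hz
  change ‖c • z‖ + psiProd (c • z) < 1
  rw [norm_smul, psiProd_smul]
  nlinarith [norm_nonneg z, psiProd_nonneg z, norm_nonneg c]

lemma zero_mem_psiDomain : (0 : Cn 2) ∈ psiDomain :=
  mem_psiDomain_of_eq_zero (by simpa using psiProd_smul 0 0) (by simp)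

lemma isDomainIn_psiDomain : IsDomainIn psiDomain := by
  refine ⟨isOpen_psiDomain, ?_⟩
  have hs : StarConvex ℝ 0 psiDomain := by
    rw [starConvex_zero_iff]
    intro x hx t ht0 ht1
    have := balanced_psiDomain (t : ℂ) (by simpa [abs_of_nonneg ht0] using ht1)
      (smul_mem_smul_set hx)
    simpa using this
  exact (hs.isPathConnected zero_mem_psiDomain).isConnected

lemma norm_exceptional : ‖(!₂[1, 0] : Cn 2)‖ = 1 := by simp [EuclideanSpace.norm_eq]

lemma exists_smul_notMem_psiDomain :
    ∃ t : ℂ, ‖t‖ < 1 ∧ t • (!₂[1, 0] : Cn 2) ∉ psiDomain := by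
  have hpos : 0 < psiProd !₂[1, 0] := (psiProd_nonneg _).lt_of_ne' psiProd_ne_zero
  have hn : ‖(((1 + psiProd !₂[1, 0])⁻¹ : ℝ) : ℂ)‖ = (1 + psiProd !₂[1, 0])⁻¹ := by
    rw [Complex.norm_real, Real.norm_of_nonneg (by positivity)]
  -- The scaling for which `‖z‖ + ψ(z)` equals exactly 1 on the ray through `(1, 0)`.
  refine ⟨(((1 + psiProd !₂[1, 0])⁻¹ : ℝ) : ℂ), ?_, fun h => ?_⟩
  · rw [hn]
    exact inv_lt_one_of_one_lt₀ (by linarith)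
  · have h' : _ + _ < (1 : ℝ) := h
    rw [psiProd_smul, norm_smul, hn, norm_exceptional, ← mul_add,
      inv_mul_cancel₀ (by positivity)] at h'
    exact lt_irrefl _ h'

lemma psiDomain_ssubset_ball : psiDomain ⊂ Metric.ball (0 : Cn 2) 1 := by
  obtain ⟨t, ht, hmem⟩ := exists_smul_notMem_psiDomain
  refine ssubset_iff_of_subset psiDomain_subset_ball |>.2 ⟨_, ?_, hmem⟩
  rwa [mem_ball_zero_iff, norm_smul, norm_exceptional, mul_one]

/-- Discs `ζ ↦ ζ • b k` in the zero cone, with `b k → (1, 0)`, all pass through 0, so no subsequence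
is compactly divergent; their limit `ζ ↦ ζ • (1, 0)` leaves D. -/
lemma not_isTaut_psiDomain : ¬ IsTaut psiDomain := by
  intro htaut
  obtain ⟨t, ht, hmem⟩ := exists_smul_notMem_psiDomain
  obtain ⟨x, hx0, hx⟩ := mem_closure_iff_seq_limit.1 (dense_psiProd_eq_zero !₂[1, 0])
  let b : ℕ → Cn 2 := fun k => ((‖x k‖ : ℂ)⁻¹) • x k
  have hb : Tendsto b atTop (𝓝 !₂[1, 0]) := by
    have h1 : Tendsto (fun k => (‖x k‖ : ℂ)) atTop (𝓝 (‖(!₂[1, 0] : Cn 2)‖ : ℂ)) :=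
      (Complex.continuous_ofReal.tendsto _).comp hx.norm
    rw [norm_exceptional] at h1
    simpa using (h1.inv₀ (by simp)).smul hx
  have hb1 (k : ℕ) : ‖b k‖ ≤ 1 := by
    simp only [b, norm_smul, norm_inv, Complex.norm_real, norm_norm]
    exact inv_mul_le_one
  have hb0 (k : ℕ) : psiProd (b k) = 0 := by
    have : psiProd (x k) = 0 := hx0 k
    simp [b, psiProd_smul, this]
  obtain ⟨s, hs, ⟨g, hg, hlim⟩ | hdiv⟩ := htaut (fun k ζ => ζ • b k) fun k => by
    refine ⟨Differentiable.differentiableOn (by fun_prop), fun ζ hζ => ?_⟩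
    have hζ' : ‖ζ‖ < 1 := mem_ball_zero_iff.1 hζ
    refine mem_psiDomain_of_eq_zero (by simp [psiProd_smul, hb0]) ?_
    rw [norm_smul]
    nlinarith [hb1 k, norm_nonneg ζ, norm_nonneg (b k)]
  · have htD : t ∈ unitDisc := mem_ball_zero_iff.2 ht
    have h1 := hlim.tendsto_at htD
    have h2 : Tendsto (fun k => t • b (s k)) atTop (𝓝 (t • !₂[1, 0])) :=
      (hb.comp hs.tendsto_atTop).const_smul t
    rw [tendsto_nhds_unique h2 h1] at hmem
    exact hmem (hg.2 htD)
  · obtain ⟨k, hk⟩ := (hdiv {0} (by simp [unitDisc]) isCompact_singleton {0}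
      (by simpa using zero_mem_psiDomain) isCompact_singleton).exists
    simp at hk

/-- The hull is open, convex and dense in the ball, and an open convex set with nonempty interior is
the interior of its closure. -/
lemma convexHull_psiDomain : convexHull ℝ psiDomain = Metric.ball (0 : Cn 2) 1 := by
  refine subset_antisymm (convexHull_min psiDomain_subset_ball (convex_ball 0 1)) ?_
  have hop : IsOpen (convexHull ℝ psiDomain) := isOpen_psiDomain.convexHull
  have hcl : Metric.ball (0 : Cn 2) 1 ⊆ closure (convexHull ℝ psiDomain) := by
    refine (dense_psiProd_eq_zero.open_subset_closure_inter Metric.isOpen_ball).trans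
      (closure_mono ?_)
    rintro z ⟨hz1, hz0⟩
    exact subset_convexHull ℝ _ (mem_psiDomain_of_eq_zero hz0 (mem_ball_zero_iff.1 hz1))
  have hint := interior_maximal hcl Metric.isOpen_ball
  rwa [(convex_convexHull ℝ psiDomain).interior_closure_eq_interior_of_nonempty_interior
    (by rw [hop.interior_eq]; exact ⟨0, subset_convexHull ℝ psiDomain zero_mem_psiDomain⟩),
    hop.interior_eq] at hint

lemma isPseudoconvex_psiDomain : IsPseudoconvex psiDomain := by
  obtain ⟨t, -, hmem⟩ := exists_smul_notMem_psiDomain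
  exact isPseudoconvex_of_entire_discs isOpen_psiDomain ⟨_, hmem⟩
    fun g hg h => apply_zero_mem_psiDomain hg h

lemma tanhExt_lempertChain_psiDomain {a : Cn 2} (ha : a ∈ psiDomain) :
    tanhExt (lempertChain psiDomain 2 0 a) = ‖a‖ := by
  rw [le_antisymm (lempertChain_psiDomain_le ha)
    (artanh_norm_le_lempertChain psiDomain_subset_ball a), tanhExt, if_neg ENNReal.ofReal_ne_top,
    ENNReal.toReal_ofReal (Real.artanh_nonneg (norm_nonneg a)), Real.tanh_artanh]
  exact ⟨by linarith [norm_nonneg a], mem_ball_zero_iff.1 (psiDomain_subset_ball ha)⟩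

theorem mainTheorem8 :
    ∃ (ψ : Cn 2 → ℝ) (D : Set (Cn 2)),
      (∀ z, 0 ≤ ψ z) ∧
      IsPSH (fun z => (ψ z : EReal)) univ ∧
      (∀ (c : ℂ) (z : Cn 2), ψ (c • z) = ‖c‖ * ψ z) ∧
      (∃ z, ψ z ≠ 0) ∧
      Dense {z | ψ z = 0} ∧
      D = {z | ‖z‖ + ψ z < 1} ∧
      IsDomainIn D ∧
      D ⊂ Metric.ball (0 : Cn 2) 1 ∧
      ¬ IsTaut D ∧
      IsPseudoconvex D ∧
      Balanced ℂ D ∧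
      convexHull ℝ D = Metric.ball (0 : Cn 2) 1 ∧
      ∀ a ∈ D, tanhExt (lempertChain D 2 0 a) = ‖a‖ :=
  ⟨psiProd, psiDomain, psiProd_nonneg, isPSH_psiProd, psiProd_smul, ⟨_, psiProd_ne_zero⟩,
    dense_psiProd_eq_zero, rfl, isDomainIn_psiDomain, psiDomain_ssubset_ball,
    not_isTaut_psiDomain, isPseudoconvex_psiDomain, balanced_psiDomain, convexHull_psiDomain,
    fun _ ha => tanhExt_lempertChain_psiDomain ha⟩
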